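/- **Proposition (Vanishing System Entropy Contribution).** Let $d\ge 0$, let $U:\mathbb{R}^d\to\mathbb{R}^d$ be globally Lipschitz, let $\mu\in\mathbb{R}^d$ and $\tau>0$. Let $\theta_k\sim\mathcal N(\mu,\tau I)$ and $\varepsilon\sim\mathcal N(0,I)$ be independent random vectors in $\mathbb{R}^d$, and for $\eta>0$ and $\sigma\neq 0$ put $$\theta_{k+1}=\theta_k-\eta\,U(\theta_k)+\sigma\varepsilon .$$ For a random vector $X$ with Lebesgue density $p$ such that $p\ln p$ is integrable, let $H(X)=-\int_{\mathbb{R}^d}p\ln p\,dx$ denote its Shannon (differential) entropy, and let $\Delta S_{\mathrm{sys}}=H(\theta_{k+1})-H(\theta_k)$. Then $\theta_k$ and, for all $\eta>0$ and $\sigma\ne0$, $\theta_{k+1}$ have Lebesgue densities and finite Shannon entropy, and with $\mu$, $\tau$ and $U$ held fixed $$\lim_{\sigma\to 0}\sigma^2\,\Delta S_{\mathrm{sys}}=0,$$ both when $\eta>0$ is held fixed and when $\eta=c\,\sigma^2$ for a fixed constant $c>0$. -/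

import Mathlib

open MeasureTheory ProbabilityTheory Filter Topology

noncomputable section

/-- One step of the noisy update with step size `η`, noise scale `σ` and noise vector `e`:
`θ ↦ θ - η U(θ) + σ e`. -/
def noisyUpdate {d : ℕ} (U : EuclideanSpace ℝ (Fin d) → EuclideanSpace ℝ (Fin d))
    (η σ : ℝ) (θ e : EuclideanSpace ℝ (Fin d)) : EuclideanSpace ℝ (Fin d) :=
  θ - η • U θ + σ • e

/-- The Lebesgue density of a law on `ℝ^d` (meaningful when the law is absolutely continuous). -/
def lebesgueDensity {d : ℕ} (ν : Measure (EuclideanSpace ℝ (Fin d)))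
    (x : EuclideanSpace ℝ (Fin d)) : ℝ :=
  (ν.rnDeriv volume x).toReal

/-- The law `ν` has a Lebesgue density `p`, and `p log p` is Lebesgue integrable: the Shannon
(differential) entropy of `ν` exists and is finite. -/
def HasShannonEntropy {d : ℕ} (ν : Measure (EuclideanSpace ℝ (Fin d))) : Prop :=
  ν ≪ volume ∧
    Integrable (fun x => lebesgueDensity ν x * Real.log (lebesgueDensity ν x)) volume

/-- The Shannon (differential) entropy `H(ν) = - ∫ p log p`, with `p` the Lebesgue density of `ν`
(and `0 log 0 = 0`). -/
def shannonEntropy {d : ℕ} (ν : Measure (EuclideanSpace ℝ (Fin d))) : ℝ :=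
  - ∫ x, lebesgueDensity ν x * Real.log (lebesgueDensity ν x)

/-- The change of system entropy `H(law of θ_{k+1}) - H(law of θ_k)` in one noisy update, where
`θ` is the random state and `ε` the random noise. -/
def systemEntropyChange {Ω : Type*} [MeasurableSpace Ω] {d : ℕ} (P : Measure Ω)
    (U : EuclideanSpace ℝ (Fin d) → EuclideanSpace ℝ (Fin d))
    (θ ε : Ω → EuclideanSpace ℝ (Fin d)) (η σ : ℝ) : ℝ :=
  shannonEntropy (P.map (fun ω => noisyUpdate U η σ (θ ω) (ε ω))) - shannonEntropy (P.map θ)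

end

/-!
The idea is to bound both sides of the entropy of the updated state by quantities that grow only
logarithmically in `σ`. If the density `p` of a law is at most `M`, then `log p ≤ log M`, and Gibbs'
inequality against the weight `exp (-‖x‖²)` bounds `-p log p` in terms of the second moment; hence
`|H| ≤ |log M| + 𝔼‖X‖² + π ^ (d / 2)`. Independent noise `σ ε` smooths any law: if the density of
`ε` is at most `M`, that of `Z + σ ε` is at most `M |σ|⁻ᵈ`. So the entropy of the updated state is
`O(|log σ| + 1 + η²)` and `σ² |log σ| → 0`.
-/

open Module
open scoped ENNReal NNReal

section BoundedDensity

lemma measurePi_mono {ι : Type*} [Fintype ι] {α : ι → Type*} [∀ i, MeasurableSpace (α i)]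
    {μ ν : ∀ i, Measure (α i)} [∀ i, SigmaFinite (μ i)] (h : ∀ i, μ i ≤ ν i) :
    Measure.pi μ ≤ Measure.pi ν := by
  have houter : (Measure.pi μ).toOuterMeasure ≤ OuterMeasure.pi fun i ↦ (ν i).toOuterMeasure := by
    refine OuterMeasure.le_pi.2 fun s _ ↦ ?_
    change Measure.pi μ (Set.univ.pi s) ≤ _
    rw [Measure.pi_pi]
    exact Finset.prod_le_prod' fun i _ ↦ h i (s i)
  refine Measure.le_iff.2 fun s hs ↦ ?_
  rw [Measure.pi_def ν, toMeasure_apply _ _ hs]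
  exact houter s

lemma gaussianPDFReal_le (μ : ℝ) (v : ℝ≥0) (x : ℝ) :
    gaussianPDFReal μ v x ≤ (√(2 * Real.pi * v))⁻¹ :=
  mul_le_of_le_one_right (by positivity) <| Real.exp_le_one_iff.2 <|
    div_nonpos_of_nonpos_of_nonneg (neg_nonpos.2 (sq_nonneg _)) (by positivity)

lemma gaussianReal_le_smul_volume (μ : ℝ) {v : ℝ≥0} (hv : v ≠ 0) :
    gaussianReal μ v ≤ ENNReal.ofReal (√(2 * Real.pi * v))⁻¹ • volume := by
  rw [gaussianReal_of_var_ne_zero μ hv, ← withDensity_const]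
  exact withDensity_mono (ae_of_all _ fun x ↦ ENNReal.ofReal_le_ofReal (gaussianPDFReal_le μ v x))

lemma gaussianReal_zero_one_le_volume : gaussianReal 0 1 ≤ volume := by
  have hone : ENNReal.ofReal (√(2 * Real.pi * (1 : ℝ≥0)))⁻¹ ≤ 1 := by
    refine ENNReal.ofReal_le_one.2 (inv_le_one_of_one_le₀ (Real.one_le_sqrt.2 ?_))
    rw [NNReal.coe_one]
    linarith [Real.pi_gt_three]
  calc gaussianReal 0 1 ≤ ENNReal.ofReal (√(2 * Real.pi * (1 : ℝ≥0)))⁻¹ • volume :=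
        gaussianReal_le_smul_volume 0 one_ne_zero
    _ ≤ (1 : ℝ≥0∞) • volume := by gcongr
    _ = volume := one_smul _ _

lemma stdGaussian_le_volume {E : Type*} [NormedAddCommGroup E] [InnerProductSpace ℝ E]
    [FiniteDimensional ℝ E] [MeasurableSpace E] [BorelSpace E] :
    stdGaussian E ≤ volume := by
  let e := (stdOrthonormalBasis ℝ E).repr.symm
  rw [← stdGaussian_map e, ← map_pi_eq_stdGaussian, ← e.measurePreserving.map_eq,
    ← (PiLp.volume_preserving_toLp (Fin (finrank ℝ E))).map_eq]
  exact Measure.map_mono (Measure.map_mono (measurePi_mono fun _ ↦ gaussianReal_zero_one_le_volume)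
    (by fun_prop)) e.continuous.measurable

lemma map_const_add_le_smul {G : Type*} [AddGroup G] [MeasurableSpace G] [MeasurableAdd G]
    {μ ρ : Measure G} [μ.IsAddLeftInvariant] {c : ℝ≥0∞} (hρ : ρ ≤ c • μ) (z : G) :
    ρ.map (z + ·) ≤ c • μ := by
  simpa only [Measure.map_smul, map_add_left_eq_self] using
    Measure.map_mono hρ (measurable_const_add z)

lemma conv_le_smul {G : Type*} [AddGroup G] [MeasurableSpace G] [MeasurableAdd₂ G]
    {μ ρ : Measure G} [μ.IsAddLeftInvariant] [SFinite ρ] (ν : Measure G) [IsProbabilityMeasure ν]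
    {c : ℝ≥0∞} (hρ : ρ ≤ c • μ) : ν ∗ ρ ≤ c • μ := by
  refine Measure.le_iff.2 fun s hs ↦ ?_
  calc (ν ∗ ρ) s = ∫⁻ z, ρ.map (z + ·) s ∂ν := by
        rw [Measure.conv, Measure.map_apply measurable_add hs,
          Measure.prod_apply (measurable_add hs)]
        refine lintegral_congr fun z ↦ ?_
        rw [Measure.map_apply (measurable_const_add z) hs]
        rfl
    _ ≤ ∫⁻ _, (c • μ) s ∂ν := lintegral_mono fun z ↦ map_const_add_le_smul hρ z s
    _ = (c • μ) s := by rw [lintegral_const, measure_univ, mul_one]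

variable {E : Type*} [NormedAddCommGroup E] [NormedSpace ℝ E] [FiniteDimensional ℝ E]
  [MeasurableSpace E] [BorelSpace E] {μ ρ : Measure E} [μ.IsAddHaarMeasure] {c : ℝ≥0∞}

lemma map_linearMap_le_smul (hρ : ρ ≤ c • μ) {f : E →ₗ[ℝ] E} (hf : LinearMap.det f ≠ 0) :
    ρ.map f ≤ (c * ENNReal.ofReal |(LinearMap.det f)⁻¹|) • μ := by
  simpa only [Measure.map_smul, Measure.map_linearMap_addHaar_eq_smul_addHaar μ hf, smul_smul]
    using Measure.map_mono hρ f.continuous_of_finiteDimensional.measurable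

lemma map_smul_le_smul (hρ : ρ ≤ c • μ) {σ : ℝ} (hσ : σ ≠ 0) :
    ρ.map (σ • ·) ≤ (c * ENNReal.ofReal |(σ ^ finrank ℝ E)⁻¹|) • μ := by
  simpa only [Measure.map_smul, Measure.map_addHaar_smul μ hσ, smul_smul]
    using Measure.map_mono hρ (measurable_const_smul σ)

lemma map_add_smul_le_smul {Ω : Type*} [MeasurableSpace Ω] {P : Measure Ω}
    [IsProbabilityMeasure P] {Z ε : Ω → E} (hZ : AEMeasurable Z P) (hε : AEMeasurable ε P)
    (hindep : IndepFun Z ε P) (hc : P.map ε ≤ c • μ) {σ : ℝ} (hσ : σ ≠ 0) :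
    P.map (fun ω ↦ Z ω + σ • ε ω) ≤ (c * ENNReal.ofReal |(σ ^ finrank ℝ E)⁻¹|) • μ := by
  have : IsProbabilityMeasure (P.map Z) := Measure.isProbabilityMeasure_map hZ
  have hmap : P.map (fun ω ↦ σ • ε ω) = (P.map ε).map (σ • ·) :=
    (AEMeasurable.map_map_of_aemeasurable (by fun_prop) hε).symm
  have hσε : IndepFun Z (fun ω ↦ σ • ε ω) P := hindep.comp measurable_id (measurable_const_smul σ)
  have hconv : P.map (fun ω ↦ Z ω + σ • ε ω) = P.map Z ∗ (P.map ε).map (σ • ·) := by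
    rw [← hmap]
    exact hσε.map_add_eq_map_conv_map₀ hZ (hε.const_smul σ)
  rw [hconv]
  exact conv_le_smul _ (map_smul_le_smul hc hσ)

open scoped MatrixOrder in
lemma det_sqrt_sq {ι : Type*} [Fintype ι] [DecidableEq ι] {S : Matrix ι ι ℝ}
    (hS : S.PosSemidef) : (CFC.sqrt S).det ^ 2 = S.det := by
  rw [sq, ← Matrix.det_mul, CFC.sqrt_mul_sqrt_self S hS.nonneg]

open scoped MatrixOrder in
lemma multivariateGaussian_le_smul_volume {ι : Type*} [Fintype ι] [DecidableEq ι]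
    (μ : EuclideanSpace ℝ ι) {S : Matrix ι ι ℝ} (hS : S.PosDef) :
    multivariateGaussian μ S ≤ ENNReal.ofReal (√S.det)⁻¹ • volume := by
  let L := Matrix.toEuclideanLin (CFC.sqrt S)
  have hL : |LinearMap.det L| = √S.det := by
    rw [← det_sqrt_sq hS.posSemidef, Real.sqrt_sq_eq_abs, ← LinearMap.det_toLin
      (EuclideanSpace.basisFun ι ℝ).toBasis, ← Matrix.toEuclideanLin_eq_toLin_orthonormal]
  have hL0 : LinearMap.det L ≠ 0 := by
    rw [← abs_pos, hL]
    exact Real.sqrt_pos.2 hS.det_pos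
  have hmap : multivariateGaussian μ S = ((stdGaussian (EuclideanSpace ℝ ι)).map L).map (μ + ·) :=
    (Measure.map_map (measurable_const_add μ) L.continuous_of_finiteDimensional.measurable).symm
  have hstd : stdGaussian (EuclideanSpace ℝ ι) ≤ (1 : ℝ≥0∞) • volume := by
    simpa only [one_smul] using stdGaussian_le_volume
  rw [hmap, ← hL, ← abs_inv, ← one_mul (ENNReal.ofReal _)]
  exact map_const_add_le_smul (map_linearMap_le_smul hstd hL0) μ

end BoundedDensity

section Entropy

lemma neg_mul_log_le {p : ℝ} (hp : 0 ≤ p) (r : ℝ) :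
    -(p * Real.log p) ≤ p * r + Real.exp (-r) := by
  rcases hp.eq_or_lt with rfl | hp
  · simpa using (Real.exp_pos (-r)).le
  have hexp : -r - Real.log p + 1 ≤ Real.exp (-r) / p := by
    simpa only [Real.exp_sub, Real.exp_log hp] using Real.add_one_le_exp (-r - Real.log p)
  linarith [(le_div_iff₀ hp).1 hexp]

lemma abs_mul_log_le {p M r : ℝ} (hp : 0 ≤ p) (hpM : p ≤ M) (hr : 0 ≤ r) :
    |p * Real.log p| ≤ p * (|Real.log M| + r) + Real.exp (-r) := by
  have hlog : p * Real.log p ≤ p * |Real.log M| := by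
    rcases hp.eq_or_lt with rfl | hp
    · simp only [zero_mul, le_refl]
    · gcongr
      exact (Real.log_le_log hp hpM).trans (le_abs_self _)
  have hneg := neg_mul_log_le hp r
  have hlogM : 0 ≤ p * |Real.log M| := by positivity
  have hpr : 0 ≤ p * r := by positivity
  rw [abs_le]
  constructor <;> linarith [Real.exp_pos (-r)]

section ReferenceWeight

variable {V : Type*} [NormedAddCommGroup V] [InnerProductSpace ℝ V] [FiniteDimensional ℝ V]
  [MeasurableSpace V] [BorelSpace V]

lemma integral_exp_neg_norm_sq :
    ∫ x : V, Real.exp (-‖x‖ ^ 2) = Real.pi ^ (finrank ℝ V / 2 : ℝ) := by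
  simpa only [neg_mul, one_mul, div_one] using
    GaussianFourier.integral_rexp_neg_mul_sq_norm (V := V) one_pos

lemma integrable_exp_neg_norm_sq : Integrable fun x : V ↦ Real.exp (-‖x‖ ^ 2) := by
  refine .of_integral_ne_zero ?_
  rw [integral_exp_neg_norm_sq]
  positivity

end ReferenceWeight

lemma rnDeriv_le_of_le_smul {α : Type*} [MeasurableSpace α] {μ ν : Measure α} [SigmaFinite ν]
    {c : ℝ≥0∞} (h : μ ≤ c • ν) : μ.rnDeriv ν ≤ᵐ[ν] fun _ ↦ c := by
  refine ae_le_of_forall_setLIntegral_le_of_sigmaFinite (μ.measurable_rnDeriv ν) fun s _ _ ↦ ?_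
  rw [setLIntegral_const]
  exact (Measure.setLIntegral_rnDeriv_le s).trans (h s)

variable {d : ℕ} {ν : Measure (EuclideanSpace ℝ (Fin d))} {M : ℝ≥0∞}

/-- An integrable bound for `p log p`, where `p ≤ M` is the Lebesgue density of `ν`; the second
summand is the reference weight of Gibbs' inequality. -/
noncomputable def entropyMajorant (ν : Measure (EuclideanSpace ℝ (Fin d))) (M : ℝ≥0∞)
    (x : EuclideanSpace ℝ (Fin d)) : ℝ :=
  lebesgueDensity ν x * (|Real.log M.toReal| + ‖x‖ ^ 2) + Real.exp (-‖x‖ ^ 2)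

lemma abs_lebesgueDensity_mul_log_le_entropyMajorant (hM : M ≠ ∞) (hν : ν ≤ M • volume) :
    ∀ᵐ x, |lebesgueDensity ν x * Real.log (lebesgueDensity ν x)| ≤ entropyMajorant ν M x := by
  filter_upwards [rnDeriv_le_of_le_smul hν] with x hx
  exact abs_mul_log_le ENNReal.toReal_nonneg (ENNReal.toReal_mono hM hx) (sq_nonneg _)

lemma integrable_lebesgueDensity_mul [SigmaFinite ν] (hν : ν ≪ volume)
    {f : EuclideanSpace ℝ (Fin d) → ℝ} (hf : Integrable f ν) :
    Integrable fun x ↦ lebesgueDensity ν x * f x :=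
  (integrable_rnDeriv_smul_iff hν).2 hf

lemma integral_lebesgueDensity_mul [SigmaFinite ν] (hν : ν ≪ volume)
    (f : EuclideanSpace ℝ (Fin d) → ℝ) :
    ∫ x, lebesgueDensity ν x * f x = ∫ x, f x ∂ν :=
  integral_rnDeriv_smul hν

lemma integrable_const_add_norm_sq [IsFiniteMeasure ν] (c : ℝ) (h2 : MemLp id 2 ν) :
    Integrable (fun x ↦ c + ‖x‖ ^ 2) ν :=
  (integrable_const c).add (h2.integrable_norm_pow two_ne_zero)

lemma integrable_entropyMajorant [IsFiniteMeasure ν] (hν : ν ≪ volume) (h2 : MemLp id 2 ν) :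
    Integrable (entropyMajorant ν M) :=
  (integrable_lebesgueDensity_mul hν (integrable_const_add_norm_sq _ h2)).add
    integrable_exp_neg_norm_sq

lemma integral_entropyMajorant [IsProbabilityMeasure ν] (hν : ν ≪ volume) (h2 : MemLp id 2 ν) :
    ∫ x, entropyMajorant ν M x =
      |Real.log M.toReal| + ∫ x, ‖x‖ ^ 2 ∂ν + Real.pi ^ (d / 2 : ℝ) := by
  have hmoment : ∫ x, (|Real.log M.toReal| + ‖x‖ ^ 2) ∂ν =
      |Real.log M.toReal| + ∫ x, ‖x‖ ^ 2 ∂ν := by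
    have hsq : Integrable (fun x ↦ ‖x‖ ^ 2) ν := h2.integrable_norm_pow two_ne_zero
    rw [integral_add (integrable_const _) hsq, integral_const, probReal_univ, one_smul]
  simp only [entropyMajorant]
  rw [integral_add (integrable_lebesgueDensity_mul hν (integrable_const_add_norm_sq _ h2))
      integrable_exp_neg_norm_sq, integral_lebesgueDensity_mul hν, hmoment,
    integral_exp_neg_norm_sq, finrank_euclideanSpace_fin]

lemma hasShannonEntropy_of_le_smul_volume [IsFiniteMeasure ν] (hM : M ≠ ∞)
    (hν : ν ≤ M • volume) (h2 : MemLp id 2 ν) : HasShannonEntropy ν := by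
  have hac : ν ≪ volume := Measure.absolutelyContinuous_of_le_smul hν
  have hp : Measurable (lebesgueDensity ν) := (ν.measurable_rnDeriv volume).ennreal_toReal
  exact ⟨hac, (integrable_entropyMajorant hac h2).mono' (hp.mul hp.log).aestronglyMeasurable
    (abs_lebesgueDensity_mul_log_le_entropyMajorant hM hν)⟩

lemma abs_shannonEntropy_le [IsProbabilityMeasure ν] (hM : M ≠ ∞) (hν : ν ≤ M • volume)
    (h2 : MemLp id 2 ν) :
    |shannonEntropy ν| ≤ |Real.log M.toReal| + ∫ x, ‖x‖ ^ 2 ∂ν + Real.pi ^ (d / 2 : ℝ) := by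
  have hac : ν ≪ volume := Measure.absolutelyContinuous_of_le_smul hν
  rw [shannonEntropy, abs_neg, ← integral_entropyMajorant hac h2, ← Real.norm_eq_abs]
  exact norm_integral_le_of_norm_le (integrable_entropyMajorant hac h2)
    (abs_lebesgueDensity_mul_log_le_entropyMajorant hM hν)

end Entropy

section SecondMoment

lemma norm_add_add_sq_le {E : Type*} [SeminormedAddCommGroup E] (a b c : E) :
    ‖a + b + c‖ ^ 2 ≤ 3 * (‖a‖ ^ 2 + ‖b‖ ^ 2 + ‖c‖ ^ 2) := by
  have htriangle : ‖a + b + c‖ ^ 2 ≤ (‖a‖ + ‖b‖ + ‖c‖) ^ 2 := by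
    gcongr
    exact norm_add₃_le
  linarith [sq_nonneg (‖a‖ - ‖b‖), sq_nonneg (‖a‖ - ‖c‖), sq_nonneg (‖b‖ - ‖c‖)]

variable {Ω : Type*} [MeasurableSpace Ω] {P : Measure Ω} {E : Type*} [NormedAddCommGroup E]

lemma integral_norm_add_add_sq_le {X Y Z : Ω → E} (hX : MemLp X 2 P) (hY : MemLp Y 2 P)
    (hZ : MemLp Z 2 P) :
    ∫ ω, ‖X ω + Y ω + Z ω‖ ^ 2 ∂P ≤
      3 * (∫ ω, ‖X ω‖ ^ 2 ∂P + ∫ ω, ‖Y ω‖ ^ 2 ∂P + ∫ ω, ‖Z ω‖ ^ 2 ∂P) := by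
  have iX : Integrable (fun ω ↦ ‖X ω‖ ^ 2) P := hX.integrable_norm_pow two_ne_zero
  have iY : Integrable (fun ω ↦ ‖Y ω‖ ^ 2) P := hY.integrable_norm_pow two_ne_zero
  have iZ : Integrable (fun ω ↦ ‖Z ω‖ ^ 2) P := hZ.integrable_norm_pow two_ne_zero
  have iXY : Integrable (fun ω ↦ ‖X ω‖ ^ 2 + ‖Y ω‖ ^ 2) P := iX.add iY
  calc ∫ ω, ‖X ω + Y ω + Z ω‖ ^ 2 ∂P
      ≤ ∫ ω, 3 * (‖X ω‖ ^ 2 + ‖Y ω‖ ^ 2 + ‖Z ω‖ ^ 2) ∂P :=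
        integral_mono (((hX.add hY).add hZ).integrable_norm_pow two_ne_zero)
          ((iXY.add iZ).const_mul 3) fun ω ↦ norm_add_add_sq_le _ _ _
    _ = _ := by rw [integral_const_mul, integral_add iXY iZ, integral_add iX iY]

lemma memLp_lipschitzWith_comp [IsFiniteMeasure P] {F : Type*} [NormedAddCommGroup F] {p : ℝ≥0∞}
    {K : ℝ≥0} {U : E → F} (hU : LipschitzWith K U) {X : Ω → E} (hX : MemLp X p P) :
    MemLp (fun ω ↦ U (X ω)) p P := by
  have hcentred : MemLp (fun ω ↦ U (X ω) - U 0) p P :=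
    (hU.sub (LipschitzWith.const (U 0))).comp_memLp (by simp) hX
  simpa only [Pi.add_def, sub_add_cancel] using hcentred.add (memLp_const (U 0))

lemma memLp_id_map [MeasurableSpace E] [BorelSpace E] [SecondCountableTopology E] {p : ℝ≥0∞}
    {X : Ω → E} (hX : MemLp X p P) : MemLp id p (P.map X) :=
  (memLp_map_measure_iff aestronglyMeasurable_id hX.1.aemeasurable).2 hX

end SecondMoment

lemma abs_log_mul_le (x y : ℝ) : |Real.log (x * y)| ≤ |Real.log x| + |Real.log y| := by
  rcases eq_or_ne x 0 with rfl | hx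
  · simp
  rcases eq_or_ne y 0 with rfl | hy
  · simp
  rw [Real.log_mul hx hy]
  exact abs_add_le _ _

lemma tendsto_sq_mul_abs_log : Tendsto (fun σ : ℝ ↦ σ ^ 2 * |Real.log σ|) (𝓝 0) (𝓝 0) := by
  have hcont : Continuous fun σ : ℝ ↦ |σ| * |σ * Real.log σ| :=
    continuous_abs.mul Real.continuous_mul_log.abs
  refine Tendsto.congr (fun σ ↦ ?_) (hcont.tendsto' 0 0 (by simp))
  rw [abs_mul, ← mul_assoc, abs_mul_abs_self, sq]

section NoisyUpdate

variable {Ω : Type*} [MeasurableSpace Ω] {P : Measure Ω} {d : ℕ}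
  {U : EuclideanSpace ℝ (Fin d) → EuclideanSpace ℝ (Fin d)}
  {θ ε : Ω → EuclideanSpace ℝ (Fin d)} {M : ℝ≥0∞}

lemma memLp_noisyUpdate {p : ℝ≥0∞} (hθ : MemLp θ p P) (hUθ : MemLp (fun ω ↦ U (θ ω)) p P)
    (hε : MemLp ε p P) (η σ : ℝ) :
    MemLp (fun ω ↦ noisyUpdate U η σ (θ ω) (ε ω)) p P :=
  (hθ.sub (hUθ.const_smul η)).add (hε.const_smul σ)

lemma integral_norm_sq_map_noisyUpdate_le (hθ : MemLp θ 2 P) (hUθ : MemLp (fun ω ↦ U (θ ω)) 2 P)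
    (hε : MemLp ε 2 P) (η σ : ℝ) :
    ∫ x, ‖x‖ ^ 2 ∂P.map (fun ω ↦ noisyUpdate U η σ (θ ω) (ε ω)) ≤
      3 * (∫ ω, ‖θ ω‖ ^ 2 ∂P + η ^ 2 * ∫ ω, ‖U (θ ω)‖ ^ 2 ∂P + σ ^ 2 * ∫ ω, ‖ε ω‖ ^ 2 ∂P) := by
  rw [integral_map (memLp_noisyUpdate hθ hUθ hε η σ).1.aemeasurable (by fun_prop)]
  simpa only [noisyUpdate, sub_eq_add_neg, Pi.smul_apply, Pi.neg_apply, norm_neg, norm_smul,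
    mul_pow, Real.norm_eq_abs, sq_abs, integral_const_mul] using
    integral_norm_add_add_sq_le hθ (hUθ.const_smul η).neg (hε.const_smul σ)

lemma map_noisyUpdate_le_smul_volume [IsProbabilityMeasure P] (hU : Measurable U)
    (hθ : AEMeasurable θ P) (hε : AEMeasurable ε P) (hindep : IndepFun θ ε P)
    (hεM : P.map ε ≤ M • volume) (η : ℝ) {σ : ℝ} (hσ : σ ≠ 0) :
    P.map (fun ω ↦ noisyUpdate U η σ (θ ω) (ε ω)) ≤
      (M * ENNReal.ofReal |(σ ^ d)⁻¹|) • volume := by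
  have hdrift : Measurable fun x ↦ x - η • U x := measurable_id.sub (hU.const_smul η)
  simpa only [finrank_euclideanSpace_fin, Function.comp_apply, id, noisyUpdate] using
    map_add_smul_le_smul (hdrift.comp_aemeasurable hθ) hε (hindep.comp hdrift measurable_id) hεM hσ

lemma hasShannonEntropy_noisyUpdate [IsProbabilityMeasure P] (hU : Measurable U)
    (hθ : MemLp θ 2 P) (hUθ : MemLp (fun ω ↦ U (θ ω)) 2 P) (hε : MemLp ε 2 P)
    (hindep : IndepFun θ ε P) (hM : M ≠ ∞) (hεM : P.map ε ≤ M • volume) (η : ℝ) {σ : ℝ}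
    (hσ : σ ≠ 0) :
    HasShannonEntropy (P.map (fun ω ↦ noisyUpdate U η σ (θ ω) (ε ω))) :=
  hasShannonEntropy_of_le_smul_volume (ENNReal.mul_ne_top hM ENNReal.ofReal_ne_top)
    (map_noisyUpdate_le_smul_volume hU hθ.1.aemeasurable hε.1.aemeasurable hindep hεM η hσ)
    (memLp_id_map (memLp_noisyUpdate hθ hUθ hε η σ))

lemma abs_shannonEntropy_noisyUpdate_le [IsProbabilityMeasure P] (hU : Measurable U)
    (hθ : MemLp θ 2 P) (hUθ : MemLp (fun ω ↦ U (θ ω)) 2 P) (hε : MemLp ε 2 P)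
    (hindep : IndepFun θ ε P) (hM : M ≠ ∞) (hεM : P.map ε ≤ M • volume) (η : ℝ) {σ : ℝ}
    (hσ : σ ≠ 0) :
    |shannonEntropy (P.map (fun ω ↦ noisyUpdate U η σ (θ ω) (ε ω)))| ≤
      |Real.log M.toReal| + d * |Real.log σ| +
        3 * (∫ ω, ‖θ ω‖ ^ 2 ∂P + η ^ 2 * ∫ ω, ‖U (θ ω)‖ ^ 2 ∂P + σ ^ 2 * ∫ ω, ‖ε ω‖ ^ 2 ∂P) +
        Real.pi ^ (d / 2 : ℝ) := by
  have hmem := memLp_noisyUpdate hθ hUθ hε η σ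
  have : IsProbabilityMeasure (P.map (fun ω ↦ noisyUpdate U η σ (θ ω) (ε ω))) :=
    Measure.isProbabilityMeasure_map hmem.1.aemeasurable
  have hlog : |Real.log (M * ENNReal.ofReal |(σ ^ d)⁻¹|).toReal| ≤
      |Real.log M.toReal| + d * |Real.log σ| := by
    rw [ENNReal.toReal_mul, ENNReal.toReal_ofReal (abs_nonneg _)]
    refine (abs_log_mul_le _ _).trans_eq ?_
    rw [Real.log_abs, Real.log_inv, Real.log_pow, abs_neg, abs_mul, Nat.abs_cast]
  refine (abs_shannonEntropy_le (ENNReal.mul_ne_top hM ENNReal.ofReal_ne_top)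
    (map_noisyUpdate_le_smul_volume hU hθ.1.aemeasurable hε.1.aemeasurable hindep hεM η hσ)
    (memLp_id_map hmem)).trans ?_
  gcongr
  exact integral_norm_sq_map_noisyUpdate_le hθ hUθ hε η σ

lemma tendsto_sq_mul_shannonEntropy_noisyUpdate [IsProbabilityMeasure P] (hU : Measurable U)
    (hθ : MemLp θ 2 P) (hUθ : MemLp (fun ω ↦ U (θ ω)) 2 P) (hε : MemLp ε 2 P)
    (hindep : IndepFun θ ε P) (hM : M ≠ ∞) (hεM : P.map ε ≤ M • volume) {η : ℝ → ℝ}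
    (hη : Tendsto (fun σ ↦ σ * η σ) (𝓝[≠] 0) (𝓝 0)) :
    Tendsto (fun σ ↦ σ ^ 2 * shannonEntropy (P.map (fun ω ↦ noisyUpdate U (η σ) σ (θ ω) (ε ω))))
      (𝓝[≠] 0) (𝓝 0) := by
  set A := ∫ ω, ‖θ ω‖ ^ 2 ∂P
  set B := ∫ ω, ‖U (θ ω)‖ ^ 2 ∂P
  set D := ∫ ω, ‖ε ω‖ ^ 2 ∂P
  set C := |Real.log M.toReal| + 3 * A + Real.pi ^ (d / 2 : ℝ)
  have hbound : ∀ σ ≠ 0,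
      ‖σ ^ 2 * shannonEntropy (P.map (fun ω ↦ noisyUpdate U (η σ) σ (θ ω) (ε ω)))‖ ≤
        d * (σ ^ 2 * |Real.log σ|) + σ ^ 2 * (C + 3 * (σ ^ 2 * D)) +
          3 * ((σ * η σ) ^ 2 * B) := by
    intro σ hσ
    rw [Real.norm_eq_abs, abs_mul, abs_of_nonneg (sq_nonneg σ)]
    refine (mul_le_mul_of_nonneg_left (abs_shannonEntropy_noisyUpdate_le hU hθ hUθ hε hindep hM
      hεM (η σ) hσ) (sq_nonneg σ)).trans_eq ?_
    ring
  refine squeeze_zero_norm' (eventually_nhdsWithin_of_forall hbound) ?_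
  have hlog : Tendsto (fun σ : ℝ ↦ d * (σ ^ 2 * |Real.log σ|)) (𝓝[≠] 0) (𝓝 0) := by
    simpa using (tendsto_sq_mul_abs_log.mono_left nhdsWithin_le_nhds).const_mul (d : ℝ)
  have hpoly : Tendsto (fun σ : ℝ ↦ σ ^ 2 * (C + 3 * (σ ^ 2 * D))) (𝓝[≠] 0) (𝓝 0) :=
    ((by fun_prop : Continuous fun σ : ℝ ↦ σ ^ 2 * (C + 3 * (σ ^ 2 * D))).tendsto' 0 0
      (by simp)).mono_left nhdsWithin_le_nhds
  have hdrift : Tendsto (fun σ ↦ 3 * ((σ * η σ) ^ 2 * B)) (𝓝[≠] 0) (𝓝 0) := by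
    simpa using ((hη.pow 2).mul_const B).const_mul 3
  simpa using (hlog.add hpoly).add hdrift

end NoisyUpdate

theorem mainTheorem6_general {Ω : Type*} [MeasurableSpace Ω] {P : Measure Ω}
    [IsProbabilityMeasure P] {d : ℕ} {U : EuclideanSpace ℝ (Fin d) → EuclideanSpace ℝ (Fin d)}
    (hU : Measurable U) {θ ε : Ω → EuclideanSpace ℝ (Fin d)} (hθ : MemLp θ 2 P)
    (hUθ : MemLp (fun ω ↦ U (θ ω)) 2 P) (hε : MemLp ε 2 P) (hindep : IndepFun θ ε P)
    {Mθ Mε : ℝ≥0∞} (hMθ : Mθ ≠ ∞) (hθM : P.map θ ≤ Mθ • volume) (hMε : Mε ≠ ∞)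
    (hεM : P.map ε ≤ Mε • volume) :
    HasShannonEntropy (P.map θ) ∧
    (∀ η σ : ℝ, σ ≠ 0 →
      HasShannonEntropy (P.map (fun ω ↦ noisyUpdate U η σ (θ ω) (ε ω)))) ∧
    ∀ η : ℝ → ℝ, Tendsto (fun σ ↦ σ * η σ) (𝓝[≠] 0) (𝓝 0) →
      Tendsto (fun σ ↦ σ ^ 2 * systemEntropyChange P U θ ε (η σ) σ) (𝓝[≠] 0) (𝓝 0) := by
  refine ⟨hasShannonEntropy_of_le_smul_volume hMθ hθM (memLp_id_map hθ),
    fun η σ ↦ hasShannonEntropy_noisyUpdate hU hθ hUθ hε hindep hMε hεM η, fun η hη ↦ ?_⟩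
  have hinitial : Tendsto (fun σ : ℝ ↦ σ ^ 2 * shannonEntropy (P.map θ)) (𝓝[≠] 0) (𝓝 0) :=
    ((by fun_prop : Continuous fun σ : ℝ ↦ σ ^ 2 * shannonEntropy (P.map θ)).tendsto' 0 0
      (by simp)).mono_left nhdsWithin_le_nhds
  simpa only [systemEntropyChange, mul_sub, sub_zero] using
    (tendsto_sq_mul_shannonEntropy_noisyUpdate hU hθ hUθ hε hindep hMε hεM hη).sub hinitial

theorem mainTheorem6 {Ω : Type*} [MeasurableSpace Ω] (P : Measure Ω) [IsProbabilityMeasure P]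
    (d : ℕ) (U : EuclideanSpace ℝ (Fin d) → EuclideanSpace ℝ (Fin d))
    (hU : ∃ K, LipschitzWith K U)
    (μ : EuclideanSpace ℝ (Fin d)) (τ : ℝ) (hτ : 0 < τ)
    (θ ε : Ω → EuclideanSpace ℝ (Fin d))
    (hθ : HasLaw θ (multivariateGaussian μ (τ • (1 : Matrix (Fin d) (Fin d) ℝ))) P)
    (hε : HasLaw ε (stdGaussian (EuclideanSpace ℝ (Fin d))) P)
    (hindep : IndepFun θ ε P) :
    HasShannonEntropy (P.map θ) ∧
    (∀ η σ : ℝ, 0 < η → σ ≠ 0 →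
      HasShannonEntropy (P.map (fun ω => noisyUpdate U η σ (θ ω) (ε ω)))) ∧
    -- the step size is held fixed
    (∀ η : ℝ, 0 < η →
      Tendsto (fun σ : ℝ => σ ^ 2 * systemEntropyChange P U θ ε η σ) (𝓝[≠] 0) (𝓝 0)) ∧
    -- the scaling regime `σ² ∝ η`
    (∀ c : ℝ, 0 < c →
      Tendsto (fun σ : ℝ => σ ^ 2 * systemEntropyChange P U θ ε (c * σ ^ 2) σ)
        (𝓝[≠] 0) (𝓝 0)) := by
  obtain ⟨K, hU⟩ := hU
  have hθ2 : MemLp θ 2 P := hθ.hasGaussianLaw.memLp_two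
  have hθM : P.map θ ≤ _ := hθ.map_eq.trans_le
    (multivariateGaussian_le_smul_volume μ (Matrix.PosDef.one.smul hτ))
  have hεM : P.map ε ≤ (1 : ℝ≥0∞) • volume := by
    rw [hε.map_eq, one_smul]
    exact stdGaussian_le_volume
  have hstep {η : ℝ → ℝ} (hη : Continuous η) :
      Tendsto (fun σ ↦ σ * η σ) (𝓝[≠] 0) (𝓝 0) :=
    ((continuous_id.mul hη).tendsto' 0 0 (zero_mul _)).mono_left nhdsWithin_le_nhds
  obtain ⟨hinitial, hupdate, hlim⟩ := mainTheorem6_general hU.continuous.measurable hθ2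
    (memLp_lipschitzWith_comp hU hθ2) hε.hasGaussianLaw.memLp_two hindep
    ENNReal.ofReal_ne_top hθM ENNReal.one_ne_top hεM
  exact ⟨hinitial, fun η σ _ ↦ hupdate η σ, fun η _ ↦ hlim _ (hstep continuous_const),
    fun c _ ↦ hlim _ (hstep (by fun_prop))⟩
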